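/- Let $G=(A\cup B,\mathcal E)$ be a finite bipartite graph, $|A|=n_A$, $|B|=n_B$, $n_B\le n_A$, in which every vertex of $A$ has degree $\Delta_A\ge 1$ and every vertex of $B$ has degree $\Delta_B$. For a set $S$ of vertices let $\Gamma(S)$ be the set of neighbours of vertices of $S$. Let $\gamma_A,\gamma_B>0$ and $0<\delta_A,\delta_B<1/6$, and assume that $G$ is left-right-expanding: $|\Gamma(S)|\ge(1-\delta_A)\Delta_A|S|$ for every $S\subseteq A$ with $|S|\le\gamma_A n_A$, and $|\Gamma(S)|\ge(1-\delta_B)\Delta_B|S|$ for every $S\subseteq B$ with $|S|\le\gamma_B n_B$. Let $H\in\mathbb F_2^{B\times A}$ be the biadjacency matrix ($H_{ba}=1$ if and only if $a\sim b$), and let $\mathcal Q_G=(\mathcal C_X,\mathcal C_Z)$ be the CSS code of length $n=n_A^2+n_B^2$, with qubits indexed by the disjoint union $A^2\cup B^2$, where $\mathcal C_X$ and $\mathcal C_Z$ are the binary codes with parity-check matrices $$H_X=\left(\mathbb 1_{n_A}\otimes H,\; H^T\otimes\mathbb 1_{n_B}\right),\qquad H_Z=\left(H\otimes\mathbb 1_{n_A},\;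 \mathbb 1_{n_B}\otimes H^T\right).$$ For an ($X$-)error $e\in\mathbb F_2^{n}$ let $\sigma(e)=H_Xe^T$ be its syndrome, and let its reduced weight $w_R(e)$ be the smallest Hamming weight of an element of the coset $e+\mathcal C_Z^\perp$. Write $|\cdot|$ for the Hamming weight. Then every error $e\in\mathbb F_2^n$ with $w_R(e)<\min(\gamma_An_A,\gamma_Bn_B)$ satisfies $$|\sigma(e)|\ \ge\ \tfrac13\,w_R(e).$$ -/

import Mathlib

open scoped Kronecker

namespace QuantumExpander

/-- `G` is a bipartite graph with sides `A` (left) and `B` (right), every vertex of `A` having degree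
`ΔA` and every vertex of `B` having degree `ΔB`. -/
structure IsBiregularBipartite {A B : Type*} [Fintype A] [Fintype B]
    (G : SimpleGraph (A ⊕ B)) [DecidableRel G.Adj] (ΔA ΔB : ℕ) : Prop where
  bipartite : G ≤ completeBipartiteGraph A B
  left_degree : ∀ a : A, G.degree (Sum.inl a) = ΔA
  right_degree : ∀ b : B, G.degree (Sum.inr b) = ΔB

/-- `(γ, δ)`-left-expansion: `|Γ(S)| ≥ (1 - δ) Δ |S|` for all `S ⊆ A` with `|S| ≤ γ |A|`. -/
def IsLeftExpanding {A B : Type*} [Fintype A] [Fintype B] [DecidableEq A] [DecidableEq B]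
    (G : SimpleGraph (A ⊕ B)) [DecidableRel G.Adj] (ΔA : ℕ) (γ δ : ℝ) : Prop :=
  ∀ S : Finset A, (S.card : ℝ) ≤ γ * Fintype.card A →
    (1 - δ) * ΔA * S.card ≤ ((S.biUnion fun a => G.neighborFinset (Sum.inl a)).card : ℝ)

/-- `(γ, δ)`-right-expansion: `|Γ(S)| ≥ (1 - δ) Δ |S|` for all `S ⊆ B` with `|S| ≤ γ |B|`. -/
def IsRightExpanding {A B : Type*} [Fintype A] [Fintype B] [DecidableEq A] [DecidableEq B]
    (G : SimpleGraph (A ⊕ B)) [DecidableRel G.Adj] (ΔB : ℕ) (γ δ : ℝ) : Prop :=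
  ∀ S : Finset B, (S.card : ℝ) ≤ γ * Fintype.card B →
    (1 - δ) * ΔB * S.card ≤ ((S.biUnion fun b => G.neighborFinset (Sum.inr b)).card : ℝ)

/-- The binary matrix `H` with rows indexed by `B`, columns indexed by `A`, and a `1` exactly at the
adjacent pairs. -/
def parityCheck {A B : Type*} (G : SimpleGraph (A ⊕ B)) [DecidableRel G.Adj] :
    Matrix B A (ZMod 2) :=
  Matrix.of fun b a => if G.Adj (Sum.inl a) (Sum.inr b) then 1 else 0

/-- The set of qubits `A² ∪ B²` (disjoint union). -/
abbrev Qubit (A B : Type*) := (A × A) ⊕ (B × B)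

/-- `H_X = (1 ⊗ H, Hᵀ ⊗ 1)`, with rows indexed by `A × B`. -/
def HX {A B : Type*} [DecidableEq A] [DecidableEq B]
    (G : SimpleGraph (A ⊕ B)) [DecidableRel G.Adj] : Matrix (A × B) (Qubit A B) (ZMod 2) :=
  Matrix.fromCols ((1 : Matrix A A (ZMod 2)) ⊗ₖ parityCheck G)
    ((parityCheck G).transpose ⊗ₖ (1 : Matrix B B (ZMod 2)))

/-- `H_Z = (H ⊗ 1, 1 ⊗ Hᵀ)`, with rows indexed by `B × A`. -/
def HZ {A B : Type*} [DecidableEq A] [DecidableEq B]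
    (G : SimpleGraph (A ⊕ B)) [DecidableRel G.Adj] : Matrix (B × A) (Qubit A B) (ZMod 2) :=
  Matrix.fromCols (parityCheck G ⊗ₖ (1 : Matrix A A (ZMod 2)))
    ((1 : Matrix B B (ZMod 2)) ⊗ₖ (parityCheck G).transpose)

/-- The classical code with parity-check matrix `M`. -/
def codeOf {m n : Type*} [Fintype n] (M : Matrix m n (ZMod 2)) : Submodule (ZMod 2) (n → ZMod 2) :=
  LinearMap.ker M.mulVecLin

/-- The dual code, for the standard dot product. -/
def dualCode {n : Type*} [Fintype n] (C : Submodule (ZMod 2) (n → ZMod 2)) :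
    Submodule (ZMod 2) (n → ZMod 2) where
  carrier := {f | ∀ x ∈ C, f ⬝ᵥ x = 0}
  zero_mem' := fun x _ => zero_dotProduct x
  add_mem' := fun {f g} hf hg x hx => by rw [add_dotProduct, hf x hx, hg x hx, add_zero]
  smul_mem' := fun c f hf x hx => by rw [smul_dotProduct, hf x hx, smul_zero]

/-- The reduced weight `w_R(e)`: the smallest Hamming weight of an element of the coset
`e + C_Z^⊥`, where `C_Z` is the code with parity-check matrix `H_Z`. -/
noncomputable def reducedWeight {A B : Type*} [Fintype A] [Fintype B] [DecidableEq A]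
    [DecidableEq B] (G : SimpleGraph (A ⊕ B)) [DecidableRel G.Adj]
    (e : Qubit A B → ZMod 2) : ℕ :=
  sInf {w : ℕ | ∃ f ∈ dualCode (codeOf (HZ G)), w = hammingNorm (e + f)}

/-- The syndrome `σ_X(e) = H_X eᵀ`. -/
def syndrome {A B : Type*} [Fintype A] [Fintype B] [DecidableEq A] [DecidableEq B]
    (G : SimpleGraph (A ⊕ B)) [DecidableRel G.Adj] (e : Qubit A B → ZMod 2) : A × B → ZMod 2 :=
  (HX G).mulVec e

end QuantumExpander

namespace QuantumExpander

open Finset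

/-! Replace `e` by a minimum-weight representative of its coset. The columns `S ⊆ A` and rows `T ⊆
B` meeting its support are then small enough for expansion, and since `δ < 1/6`, every nonempty
subset of `S` or `T` has a vertex with more than two thirds of its neighbours unique
(`exists_many_unique_neighbors`).

Such vertices `a` and `b` determine a generator on whose unique checks the syndrome is just `e (x,
a) + e (b, y)`. Either the error fills the unique part of the generator, and adding the generator
lowers the weight, or flipping the error there, or its complement there, lowers the syndrome weight
by at least half the number of flipped qubits (`two_mul_decrease_ge`). If no `b` is visible, or the
`A²` part vanishes, flipping a single qubit lowers the syndrome. This is `exists_isImprovement`.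

Every move stays supported in the fixed `S` and `T`, so the argument can be repeated with no control
on the weight of intermediate errors. Summing the drops bounds the reduced weight by three times the
syndrome weight. -/

/-! ### Unique neighbours from expansion -/

/-- The neighbours of `a` that are not neighbours of another element of `S`. -/
def uniqueNbrs {α β : Type*} [DecidableEq α] [DecidableEq β] (r : α → Finset β) (S : Finset α)
    (a : α) : Finset β :=
  (r a).filter fun b => ∀ a' ∈ S, b ∈ r a' → a' = a

/-- The neighbours of `a` that are neighbours of another element of `S`. -/
def sharedNbrs {α β : Type*} [DecidableEq α] [DecidableEq β] (r : α → Finset β) (S : Finset α)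
    (a : α) : Finset β :=
  (r a).filter fun b => ¬ ∀ a' ∈ S, b ∈ r a' → a' = a

lemma uniqueNbrs_union_sharedNbrs {α β : Type*} [DecidableEq α] [DecidableEq β]
    (r : α → Finset β) (S : Finset α) (a : α) : uniqueNbrs r S a ∪ sharedNbrs r S a = r a :=
  Finset.filter_union_filter_not_eq _ _

/-- Every nonempty subset of `S` has an element with more than twice as many unique as shared
neighbours. -/
def IsUniqueNbrRich {α β : Type*} [DecidableEq α] [DecidableEq β] (r : α → Finset β)
    (S : Finset α) : Prop :=
  ∀ S' ⊆ S, S'.Nonempty → ∃ a ∈ S', 2 * (sharedNbrs r S' a).card < (uniqueNbrs r S' a).card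

/-- In a left-regular bipartite relation whose neighbourhood of `S` is nearly as large as possible,
some vertex of `S` has more than two thirds of its neighbours unique. -/
lemma exists_many_unique_neighbors {α β : Type*} [DecidableEq α] [DecidableEq β] [Fintype β]
    (r : α → Finset β) (S : Finset α) (hS : S.Nonempty) (Δ : ℕ) (hΔ : 0 < Δ) (δ : ℝ)
    (hδ : δ < 1 / 6) (hr : ∀ a ∈ S, (r a).card = Δ)
    (hexp : (1 - δ) * Δ * S.card ≤ ((S.biUnion r).card : ℝ)) :
    ∃ a ∈ S, 2 * (sharedNbrs r S a).card < (uniqueNbrs r S a).card := by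
  by_contra! hcon
  have h1 : ∀ a ∈ S, Δ ≤ 3 * (sharedNbrs r S a).card := by
    intro a ha
    have h2 := Finset.card_union_le (uniqueNbrs r S a) (sharedNbrs r S a)
    have h3 := hcon a ha
    rw [uniqueNbrs_union_sharedNbrs, hr a ha] at h2
    omega
  have hswap : ∀ f : α → Finset β, ∑ a ∈ S, (f a).card =
      ∑ b : β, (S.filter fun a => b ∈ f a).card := by
    intro f
    simp_rw [Finset.card_filter]
    rw [Finset.sum_comm]
    refine Finset.sum_congr rfl fun a _ => ?_
    simp
  -- Double counting over `b`: if `b` has `d ≥ 1` neighbours in `S`, it is shared by `0` of them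
  -- when `d = 1` and by at most `d` otherwise, so shared incidences plus `2` never exceed `2 * d`.
  have h4 : ∑ a ∈ S, (sharedNbrs r S a).card + 2 * (S.biUnion r).card ≤ 2 * ∑ a ∈ S, (r a).card := by
    rw [hswap, hswap]
    have h5 : (S.biUnion r).card = ∑ b : β, if b ∈ S.biUnion r then 1 else 0 := by
      rw [Finset.sum_ite_mem, Finset.univ_inter, Finset.card_eq_sum_ones]
    rw [h5, Finset.mul_sum, Finset.mul_sum, ← Finset.sum_add_distrib]
    refine Finset.sum_le_sum fun b _ => ?_
    have hsub : (S.filter fun a => b ∈ sharedNbrs r S a) ⊆ S.filter fun a => b ∈ r a := by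
      intro a ha
      simp only [sharedNbrs, Finset.mem_filter] at ha ⊢
      exact ⟨ha.1, ha.2.1⟩
    have hle := Finset.card_le_card hsub
    by_cases hb : b ∈ S.biUnion r
    · rw [if_pos hb]
      obtain ⟨a, ha, hba⟩ := Finset.mem_biUnion.1 hb
      have hpos : 0 < (S.filter fun a => b ∈ r a).card :=
        Finset.card_pos.2 ⟨a, Finset.mem_filter.2 ⟨ha, hba⟩⟩
      by_cases hone : (S.filter fun a => b ∈ r a).card = 1
      · have hzero : (S.filter fun a => b ∈ sharedNbrs r S a) = ∅ := by
          obtain ⟨c, hc⟩ := Finset.card_eq_one.1 hone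
          refine Finset.filter_eq_empty_iff.2 fun a ha hab => ?_
          simp only [sharedNbrs, Finset.mem_filter] at hab
          refine hab.2 fun a' ha' hba' => ?_
          have e1 : a' ∈ S.filter fun a => b ∈ r a := Finset.mem_filter.2 ⟨ha', hba'⟩
          have e2 : a ∈ S.filter fun a => b ∈ r a := Finset.mem_filter.2 ⟨ha, hab.1⟩
          rw [hc, Finset.mem_singleton] at e1 e2
          rw [e1, e2]
        rw [hzero, hone]
        simp
      · omega
    · rw [if_neg hb]
      omega
  have h6 : Δ * S.card ≤ 3 * ∑ a ∈ S, (sharedNbrs r S a).card := by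
    rw [Finset.mul_sum, mul_comm, ← smul_eq_mul]
    exact Finset.card_nsmul_le_sum S _ _ h1
  have h7 : ∑ a ∈ S, (r a).card = S.card * Δ := by
    rw [Finset.sum_congr rfl hr, Finset.sum_const, smul_eq_mul]
  rw [h7] at h4
  have h8 : (0 : ℝ) < Δ * S.card := by
    have := Finset.card_pos.2 hS
    positivity
  have h4' : ((∑ a ∈ S, (sharedNbrs r S a).card : ℕ) : ℝ) + 2 * (S.biUnion r).card ≤
      2 * (S.card * Δ) := by
    exact_mod_cast h4
  have h6' : (Δ : ℝ) * S.card ≤ 3 * ((∑ a ∈ S, (sharedNbrs r S a).card : ℕ) : ℝ) := by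
    exact_mod_cast h6
  -- The shared total is at most `2δΔ|S|` and at least `Δ|S|/3`, which forces `δ ≥ 1/6`.
  nlinarith

/-! ### Numerical and rectangle estimates -/

/-- The variables are the sizes of `P, P', C, Q, Q', D`: flipping `(P, Q)` or `(P', Q')` costs at
most twice the syndrome drop. Multiplying `2d + 1 ≤ q + q'` by `p` and `2c + 1 ≤ p + p'` by `q`
reduces the first alternative to `2pq ≤ pq' + p'q`; the second is symmetric. -/
lemma two_mul_decrease_ge (p p' c q q' d : ℕ) (hp : 2 * c < p + p') (hq : 2 * d < q + q') :
    p + q + 2 * (p * d + c * q) ≤ 2 * (p * q' + p' * q) ∨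
      p' + q' + 2 * (p' * d + c * q') ≤ 2 * (p' * q + p * q') := by
  zify at *
  -- By AM-GM, `(2pq)(2p'q') = 4(pq')(p'q) ≤ (pq' + p'q)²`, so both factors cannot exceed `pq' +
  -- p'q`.
  have key : 2 * ((p : ℤ) * q) ≤ p * q' + q * p' ∨ 2 * ((p' : ℤ) * q') ≤ p * q' + q * p' := by
    by_contra! h
    have hu : (0 : ℤ) ≤ p * q' + q * p' := by positivity
    nlinarith [mul_lt_mul'' h.1 h.2 hu hu, sq_nonneg ((p : ℤ) * q' - q * p')]
  rcases key with h | h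
  · left
    nlinarith [mul_le_mul_of_nonneg_left (Int.add_one_le_of_lt hq) (Int.natCast_nonneg p),
      mul_le_mul_of_nonneg_left (Int.add_one_le_of_lt hp) (Int.natCast_nonneg q)]
  · right
    nlinarith [mul_le_mul_of_nonneg_left (Int.add_one_le_of_lt hq) (Int.natCast_nonneg p'),
      mul_le_mul_of_nonneg_left (Int.add_one_le_of_lt hp) (Int.natCast_nonneg q')]

lemma hammingNorm_eq_sum {ι : Type*} [Fintype ι] (s : ι → ZMod 2) :
    hammingNorm s = ∑ x, if s x = 0 then 0 else 1 := by
  rw [hammingNorm, Finset.card_filter]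
  exact Finset.sum_congr rfl fun x _ => by by_cases h : s x = 0 <;> simp [h]

lemma card_mul_card_eq_sum {A B : Type*} [Fintype A] [Fintype B] [DecidableEq A] [DecidableEq B]
    (P : Finset A) (Q : Finset B) :
    P.card * Q.card = ∑ x : A × B, if x.1 ∈ P ∧ x.2 ∈ Q then 1 else 0 := by
  rw [← Finset.card_product, ← Finset.card_filter]
  congr 1
  ext x
  simp

lemma zmod_two_eq_one_of_ne_zero {x : ZMod 2} (h : x ≠ 0) : x = 1 := by
  revert x; decide

/-- Flipping the checks of `P × (Q' ∪ D)` and `(P' ∪ C) × Q` lowers the weight of a vector which is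
`1` on `P × Q'` and `P' × Q`, up to the contributions of `C` and `D`. -/
lemma hammingNorm_add_rectangles {A B : Type*} [Fintype A] [Fintype B] [DecidableEq A]
    [DecidableEq B] (s t : A × B → ZMod 2) (P P' C : Finset A) (Q Q' D : Finset B)
    (hP : Disjoint P P') (hQ : Disjoint Q Q')
    (hsPQ : ∀ a ∈ P, ∀ b ∈ Q', s (a, b) = 1) (hsQP : ∀ a ∈ P', ∀ b ∈ Q, s (a, b) = 1)
    (ht : ∀ a b, t (a, b) = (if a ∈ P ∧ b ∈ Q ∪ Q' ∪ D then 1 else 0) +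
      (if a ∈ P ∪ P' ∪ C ∧ b ∈ Q then 1 else 0)) :
    hammingNorm (s + t) + (P.card * Q'.card + P'.card * Q.card) ≤
      hammingNorm s + (P.card * D.card + C.card * Q.card) := by
  simp only [hammingNorm_eq_sum, card_mul_card_eq_sum, ← Finset.sum_add_distrib]
  -- The inequality holds check by check: on `P × Q` the two rectangles cancel, and only checks in
  -- `P × D` or `C × Q` can become unsatisfied.
  refine Finset.sum_le_sum fun x _ => ?_
  obtain ⟨a, b⟩ := x
  have h2 : (1 : ZMod 2) + 1 = 0 := by decide
  have hP' : a ∈ P → a ∉ P' := fun h h' => Finset.disjoint_left.1 hP h h'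
  have hQ' : b ∈ Q → b ∉ Q' := fun h h' => Finset.disjoint_left.1 hQ h h'
  simp only [Pi.add_apply, ht, Finset.mem_union]
  by_cases h1 : a ∈ P <;> by_cases h3 : b ∈ Q
  · simp [h1, h3, hP' h1, hQ' h3, h2]
  · by_cases h4 : b ∈ Q'
    · simp [h1, h3, h4, hP' h1, hsPQ a h1 b h4, h2]
    · by_cases h5 : b ∈ D
      · simp only [h1, h3, h4, h5, hP' h1]
        simp
        split_ifs <;> simp
      · simp [h1, h3, h4, h5, hP' h1]
  · by_cases h4 : a ∈ P'
    · simp [h1, h3, h4, hQ' h3, hsQP a h4 b h3, h2]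
    · by_cases h5 : a ∈ C
      · simp only [h1, h3, h4, h5, hQ' h3]
        simp
        split_ifs <;> simp
      · simp [h1, h3, h4, h5, hQ' h3]
  · simp [h1, h3]

/-! ### Neighbourhoods and supports -/

/-- The neighbours in `B` of a vertex of `A`. -/
def leftNbrs {A B : Type*} [Fintype B] (G : SimpleGraph (A ⊕ B)) [DecidableRel G.Adj] (a : A) :
    Finset B :=
  univ.filter fun b => G.Adj (Sum.inl a) (Sum.inr b)

/-- The neighbours in `A` of a vertex of `B`. -/
def rightNbrs {A B : Type*} [Fintype A] (G : SimpleGraph (A ⊕ B)) [DecidableRel G.Adj] (b : B) :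
    Finset A :=
  univ.filter fun a => G.Adj (Sum.inl a) (Sum.inr b)

lemma mem_leftNbrs {A B : Type*} [Fintype B] {G : SimpleGraph (A ⊕ B)} [DecidableRel G.Adj]
    {a : A} {b : B} : b ∈ leftNbrs G a ↔ G.Adj (Sum.inl a) (Sum.inr b) := by simp [leftNbrs]

lemma mem_rightNbrs {A B : Type*} [Fintype A] {G : SimpleGraph (A ⊕ B)} [DecidableRel G.Adj]
    {a : A} {b : B} : a ∈ rightNbrs G b ↔ G.Adj (Sum.inl a) (Sum.inr b) := by simp [rightNbrs]

/-- The errors whose part in `A²` lies in `A × S` and whose part in `B²` lies in `T × B`. -/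
def IsSupportedIn {A B : Type*} (S : Finset A) (T : Finset B) (e : Qubit A B → ZMod 2) : Prop :=
  (∀ a' a, e (Sum.inl (a', a)) ≠ 0 → a ∈ S) ∧ ∀ b b', e (Sum.inr (b, b')) ≠ 0 → b ∈ T

lemma IsSupportedIn.add {A B : Type*} {S : Finset A} {T : Finset B} {e f : Qubit A B → ZMod 2}
    (he : IsSupportedIn S T e) (hf : IsSupportedIn S T f) : IsSupportedIn S T (e + f) := by
  constructor
  · intro a' a h
    by_contra ha
    exact h (by rw [Pi.add_apply, not_not.1 (mt (he.1 a' a) ha), not_not.1 (mt (hf.1 a' a) ha),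
      add_zero])
  · intro b b' h
    by_contra hb
    exact h (by rw [Pi.add_apply, not_not.1 (mt (he.2 b b') hb), not_not.1 (mt (hf.2 b b') hb),
      add_zero])

section

variable {A B : Type*} [Fintype A] [Fintype B]

lemma exists_isSupportedIn (e : Qubit A B → ZMod 2) :
    ∃ (S : Finset A) (T : Finset B), IsSupportedIn S T e ∧ S.card ≤ hammingNorm e ∧
      T.card ≤ hammingNorm e := by
  refine ⟨univ.filter fun a => ∃ x, e (Sum.inl (x, a)) ≠ 0,
    univ.filter fun b => ∃ y, e (Sum.inr (b, y)) ≠ 0, ⟨fun x a h => ?_, fun b y h => ?_⟩, ?_, ?_⟩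
  · exact Finset.mem_filter.2 ⟨Finset.mem_univ _, x, h⟩
  · exact Finset.mem_filter.2 ⟨Finset.mem_univ _, y, h⟩
  · choose! x hx using fun (a : A) (h : ∃ x, e (Sum.inl (x, a)) ≠ 0) => h
    refine Finset.card_le_card_of_injOn (fun a => Sum.inl (x a, a)) (fun a ha => ?_)
      (fun a _ a' _ h => (Prod.ext_iff.1 (Sum.inl.inj h)).2)
    simp only [Finset.coe_filter, Finset.mem_univ, true_and, Set.mem_ofPred_eq] at ha ⊢
    exact hx a ha
  · choose! y hy using fun (b : B) (h : ∃ y, e (Sum.inr (b, y)) ≠ 0) => h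
    refine Finset.card_le_card_of_injOn (fun b => Sum.inr (b, y b)) (fun b hb => ?_)
      (fun b _ b' _ h => (Prod.ext_iff.1 (Sum.inr.inj h)).1)
    simp only [Finset.coe_filter, Finset.mem_univ, true_and, Set.mem_ofPred_eq] at hb ⊢
    exact hy b hb

variable (G : SimpleGraph (A ⊕ B)) [DecidableRel G.Adj]

lemma mem_leftNbrs_iff_mem_rightNbrs (a : A) (b : B) :
    b ∈ leftNbrs G a ↔ a ∈ rightNbrs G b := by rw [mem_leftNbrs, mem_rightNbrs]

lemma neighborFinset_inl {ΔA ΔB : ℕ} (h : IsBiregularBipartite G ΔA ΔB) (a : A) :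
    G.neighborFinset (Sum.inl a) = (leftNbrs G a).map Function.Embedding.inr := by
  ext v
  rcases v with x | y
  · simpa using fun hx => by simpa using h.bipartite hx
  · simp [mem_leftNbrs]

lemma neighborFinset_inr {ΔA ΔB : ℕ} (h : IsBiregularBipartite G ΔA ΔB) (b : B) :
    G.neighborFinset (Sum.inr b) = (rightNbrs G b).map Function.Embedding.inl := by
  ext v
  rcases v with x | y
  · simp [mem_rightNbrs, G.adj_comm]
  · simpa using fun hx => by simpa using h.bipartite hx

lemma right_degree_pos {ΔA ΔB : ℕ} (h : IsBiregularBipartite G ΔA ΔB) (hΔA : 0 < ΔA) (a : A) :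
    0 < ΔB := by
  have h1 : 0 < (leftNbrs G a).card := by
    rwa [← h.left_degree a, ← G.card_neighborFinset_eq_degree, neighborFinset_inl G h,
      Finset.card_map] at hΔA
  obtain ⟨b, hb⟩ := Finset.card_pos.1 h1
  rw [← h.right_degree b, G.degree_pos_iff_exists_adj]
  exact ⟨_, ((mem_leftNbrs).1 hb).symm⟩

end

/-! ### Cross errors, syndromes and generators -/

variable {A B : Type*} [DecidableEq A] [DecidableEq B]

/-- The error supported on `P × {a}` in `A²` and on `{b} × Q` in `B²`. -/
def crossError (a : A) (b : B) (P : Finset A) (Q : Finset B) : Qubit A B → ZMod 2 :=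
  Sum.elim (fun x => if x.2 = a ∧ x.1 ∈ P then 1 else 0)
    (fun y => if y.1 = b ∧ y.2 ∈ Q then 1 else 0)

lemma isSupportedIn_crossError {S : Finset A} {T : Finset B} {a : A} {b : B} {P : Finset A}
    {Q : Finset B} (ha : P.Nonempty → a ∈ S) (hb : Q.Nonempty → b ∈ T) :
    IsSupportedIn S T (crossError a b P Q) := by
  constructor
  · intro x y h
    simp only [crossError, Sum.elim_inl, ne_eq, ite_eq_right_iff, Classical.not_imp] at h
    rw [h.1.1]
    exact ha ⟨x, h.1.2⟩
  · intro x y h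
    simp only [crossError, Sum.elim_inr, ne_eq, ite_eq_right_iff, Classical.not_imp] at h
    rw [h.1.1]
    exact hb ⟨y, h.1.2⟩

variable [Fintype A] [Fintype B]

lemma hammingNorm_crossError (a : A) (b : B) (P : Finset A) (Q : Finset B) :
    hammingNorm (crossError a b P Q) = P.card + Q.card := by
  rw [hammingNorm_eq_sum, Fintype.sum_sum_type, Fintype.sum_prod_type_right, Fintype.sum_prod_type]
  have h1 : ∀ y, (∑ x, if crossError a b P Q (Sum.inl (x, y)) = 0 then 0 else 1) =
      if y = a then P.card else 0 := by
    intro y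
    by_cases h : y = a <;> simp [crossError, h]
  have h2 : ∀ x, (∑ y, if crossError a b P Q (Sum.inr (x, y)) = 0 then 0 else 1) =
      if x = b then Q.card else 0 := by
    intro x
    by_cases h : x = b <;> simp [crossError, h]
  simp [h1, h2]

variable (G : SimpleGraph (A ⊕ B)) [DecidableRel G.Adj]

lemma syndrome_apply (e : Qubit A B → ZMod 2) (a : A) (b : B) :
    syndrome G e (a, b) = ∑ a' ∈ rightNbrs G b, e (Sum.inl (a, a')) +
      ∑ b' ∈ leftNbrs G a, e (Sum.inr (b', b)) := by
  rw [syndrome, HX, Matrix.mulVec, dotProduct, Fintype.sum_sum_type, Fintype.sum_prod_type,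
    Fintype.sum_prod_type_right, Finset.sum_comm]
  simp [Matrix.one_apply, parityCheck, rightNbrs, leftNbrs, Finset.sum_filter, ite_mul]

lemma syndrome_add (e f : Qubit A B → ZMod 2) :
    syndrome G (e + f) = syndrome G e + syndrome G f :=
  Matrix.mulVec_add _ _ _

lemma syndrome_crossError (a : A) (b : B) (P : Finset A) (Q : Finset B) (x : A) (y : B) :
    syndrome G (crossError a b P Q) (x, y) = (if x ∈ P ∧ y ∈ leftNbrs G a then 1 else 0) +
      (if x ∈ rightNbrs G b ∧ y ∈ Q then 1 else 0) := by
  rw [syndrome_apply]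
  simp only [crossError, Sum.elim_inl, Sum.elim_inr, ite_and, Finset.sum_ite_eq', mem_leftNbrs,
    mem_rightNbrs]
  split_ifs <;> rfl

/-- The generator of `C_Z^⊥` indexed by `(b, a)`. -/
def generator (a : A) (b : B) : Qubit A B → ZMod 2 :=
  crossError a b (rightNbrs G b) (leftNbrs G a)

lemma generator_eq_row (a : A) (b : B) : generator G a b = HZ G (b, a) := by
  funext q
  rcases q with ⟨x, y⟩ | ⟨x, y⟩
  · simp only [generator, crossError, HZ, mem_rightNbrs, Matrix.fromCols_apply_inl, Sum.elim_inl,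
      Matrix.kroneckerMap_apply, parityCheck, Matrix.of_apply, Matrix.one_apply]
    grind
  · simp only [generator, crossError, HZ, mem_leftNbrs, Matrix.fromCols_apply_inr, Sum.elim_inr,
      Matrix.kroneckerMap_apply, parityCheck, Matrix.of_apply, Matrix.one_apply,
      Matrix.transpose_apply]
    grind

lemma generator_mem_dualCode (a : A) (b : B) : generator G a b ∈ dualCode (codeOf (HZ G)) := by
  intro x hx
  rw [generator_eq_row]
  exact congrFun hx (b, a)

lemma syndrome_generator (a : A) (b : B) : syndrome G (generator G a b) = 0 := by
  funext ⟨x, y⟩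
  rw [generator, syndrome_crossError]
  exact CharTwo.add_self_eq_zero _

/-- Each row of `HX` lies in `C_Z` because generators have zero syndrome; elements of the dual are
therefore orthogonal to it. -/
lemma syndrome_eq_zero_of_mem_dualCode {f : Qubit A B → ZMod 2}
    (hf : f ∈ dualCode (codeOf (HZ G))) : syndrome G f = 0 := by
  funext ⟨x, y⟩
  rw [syndrome, Matrix.mulVec, dotProduct_comm]
  refine hf _ ?_
  rw [codeOf, LinearMap.mem_ker, Matrix.mulVecLin_apply]
  funext ⟨b, a⟩
  rw [Matrix.mulVec, ← generator_eq_row, dotProduct_comm]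
  exact congrFun (syndrome_generator G a b) (x, y)

/-! ### Reduced weight -/

lemma exists_reducedWeight_eq (e : Qubit A B → ZMod 2) :
    ∃ f ∈ dualCode (codeOf (HZ G)), reducedWeight G e = hammingNorm (e + f) :=
  Nat.sInf_mem (s := {w : ℕ | ∃ f ∈ dualCode (codeOf (HZ G)), w = hammingNorm (e + f)})
    ⟨_, 0, Submodule.zero_mem _, rfl⟩

lemma reducedWeight_le {e f : Qubit A B → ZMod 2} (hf : f ∈ dualCode (codeOf (HZ G))) :
    reducedWeight G e ≤ hammingNorm (e + f) :=
  Nat.sInf_le ⟨f, hf, rfl⟩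

lemma hammingNorm_add_le {ι : Type*} [Fintype ι] (x y : ι → ZMod 2) :
    hammingNorm (x + y) ≤ hammingNorm x + hammingNorm y := by
  simp only [hammingNorm_eq_sum, ← Finset.sum_add_distrib]
  refine Finset.sum_le_sum fun i _ => ?_
  by_cases hx : x i = 0 <;> by_cases hy : y i = 0 <;> simp [hx, hy]
  split_ifs <;> simp

lemma reducedWeight_le_add (e f : Qubit A B → ZMod 2) :
    reducedWeight G e ≤ reducedWeight G (e + f) + hammingNorm f := by
  obtain ⟨g, hg, h⟩ := exists_reducedWeight_eq G (e + f)
  rw [h]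
  have h1 : e + g = (e + f + g) + f := by
    funext q
    simp only [Pi.add_apply]
    rw [add_right_comm (e q), add_assoc, CharTwo.add_self_eq_zero, add_zero]
  exact (reducedWeight_le G hg).trans (h1 ▸ hammingNorm_add_le _ _)

lemma reducedWeight_le_reducedWeight_add {e f : Qubit A B → ZMod 2}
    (hf : f ∈ dualCode (codeOf (HZ G))) : reducedWeight G e ≤ reducedWeight G (e + f) := by
  obtain ⟨g, hg, h⟩ := exists_reducedWeight_eq G (e + f)
  rw [h, add_assoc]
  exact reducedWeight_le G (Submodule.add_mem _ hf hg)

/-- A unique neighbour `b` sees only `a` inside `S`, so its parity sum reads off a single value. -/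
lemma sum_eq_of_mem_uniqueNbrs {α β : Type*} [DecidableEq α] [DecidableEq β]
    {r : α → Finset β} {r' : β → Finset α} (hr : ∀ a b, b ∈ r a ↔ a ∈ r' b) {S : Finset α} {a : α}
    {b : β} (hb : b ∈ uniqueNbrs r S a) (f : α → ZMod 2) (hf : ∀ a', f a' ≠ 0 → a' ∈ S) :
    ∑ a' ∈ r' b, f a' = f a := by
  rw [uniqueNbrs, Finset.mem_filter] at hb
  refine Finset.sum_eq_single_of_mem a ((hr _ _).1 hb.1) fun a' ha' hne => ?_
  by_contra h
  exact hne (hb.2 a' (hf a' h) ((hr _ _).2 ha'))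

/-! ### Local improvements -/

/-- Adding `f` to `e` makes progress towards a codeword: either `f` is stabilizer and the weight
drops, or the syndrome weight drops by at least a third of the weight of `f`. -/
def IsImprovement (e f : Qubit A B → ZMod 2) : Prop :=
  (f ∈ dualCode (codeOf (HZ G)) ∧ hammingNorm (e + f) < hammingNorm e) ∨
    (hammingNorm (syndrome G (e + f)) < hammingNorm (syndrome G e) ∧
      hammingNorm f + 3 * hammingNorm (syndrome G (e + f)) ≤ 3 * hammingNorm (syndrome G e))

/-- A qubit of `A²` with many unsatisfied checks can be flipped. -/
lemma isImprovement_left (e : Qubit A B → ZMod 2) (x a : A) (b : B) (Q' D : Finset B)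
    (hQ : Q' ∪ D = leftNbrs G a) (hs : ∀ y ∈ Q', syndrome G e (x, y) = 1)
    (hc : D.card < Q'.card) : IsImprovement G e (crossError a b {x} ∅) := by
  have h := hammingNorm_add_rectangles (syndrome G e) (syndrome G (crossError a b {x} ∅))
    {x} ∅ ∅ ∅ Q' D (by simp) (by simp) (by simpa using hs) (by simp) (by
      intro u v
      rw [syndrome_crossError, Finset.empty_union, hQ]
      simp)
  rw [← syndrome_add] at h
  simp only [Finset.card_singleton, Finset.card_empty] at h
  right
  rw [hammingNorm_crossError, Finset.card_singleton, Finset.card_empty]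
  omega

/-- A qubit of `B²` with many unsatisfied checks can be flipped. -/
lemma isImprovement_right (e : Qubit A B → ZMod 2) (a : A) (b y : B) (P' C : Finset A)
    (hP : P' ∪ C = rightNbrs G b) (hs : ∀ x ∈ P', syndrome G e (x, y) = 1)
    (hc : C.card < P'.card) : IsImprovement G e (crossError a b ∅ {y}) := by
  have h := hammingNorm_add_rectangles (syndrome G e) (syndrome G (crossError a b ∅ {y}))
    ∅ P' C {y} ∅ ∅ (by simp) (by simp) (by simp) (by simpa using hs) (by
      intro u v
      rw [syndrome_crossError, Finset.empty_union, hP]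
      simp)
  rw [← syndrome_add] at h
  simp only [Finset.card_singleton, Finset.card_empty] at h
  right
  rw [hammingNorm_crossError, Finset.card_singleton, Finset.card_empty]
  omega

lemma isImprovement_cross (e : Qubit A B → ZMod 2) (a : A) (b : B) (P P' C : Finset A)
    (Q Q' D : Finset B) (hPP : Disjoint P P') (hQQ : Disjoint Q Q')
    (hP : P ∪ P' ∪ C = rightNbrs G b) (hQ : Q ∪ Q' ∪ D = leftNbrs G a)
    (hsPQ : ∀ x ∈ P, ∀ y ∈ Q', syndrome G e (x, y) = 1)
    (hsQP : ∀ x ∈ P', ∀ y ∈ Q, syndrome G e (x, y) = 1)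
    (hpos : 0 < P.card + Q.card)
    (hc : P.card + Q.card + 2 * (P.card * D.card + C.card * Q.card) ≤
      2 * (P.card * Q'.card + P'.card * Q.card)) :
    IsImprovement G e (crossError a b P Q) := by
  have h := hammingNorm_add_rectangles (syndrome G e) (syndrome G (crossError a b P Q))
    P P' C Q Q' D hPP hQQ hsPQ hsQP (by
      intro u v
      rw [syndrome_crossError, hP, hQ])
  rw [← syndrome_add] at h
  right
  rw [hammingNorm_crossError]
  omega

/-- A generator all of whose qubits outside a minority are in the error lowers the weight. -/
lemma hammingNorm_add_generator_lt (e : Qubit A B → ZMod 2) (a : A) (b : B) (P C : Finset A)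
    (Q D : Finset B) (hP : P ∪ C = rightNbrs G b) (hQ : Q ∪ D = leftNbrs G a)
    (heP : ∀ x ∈ P, e (Sum.inl (x, a)) = 1) (heQ : ∀ y ∈ Q, e (Sum.inr (b, y)) = 1)
    (hc : C.card + D.card < P.card + Q.card) :
    hammingNorm (e + generator G a b) < hammingNorm e := by
  have h : hammingNorm (e + generator G a b) + hammingNorm (crossError a b P Q) ≤
      hammingNorm e + hammingNorm (crossError a b C D) := by
    simp only [hammingNorm_eq_sum, ← Finset.sum_add_distrib]
    refine Finset.sum_le_sum fun q _ => ?_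
    rcases q with ⟨x, y⟩ | ⟨x, y⟩
    · have h1 := heP x
      simp only [Pi.add_apply, generator, crossError, Sum.elim_inl, ← hP, Finset.mem_union]
      by_cases hy : y = a
      · subst hy
        by_cases hxP : x ∈ P
        · simp [hxP, h1 hxP, CharTwo.add_self_eq_zero]
        · by_cases hxC : x ∈ C
          · simp only [hxP, hxC]
            simp
            split_ifs <;> simp
          · simp [hxP, hxC]
      · simp [hy]
    · have h1 := heQ y
      simp only [Pi.add_apply, generator, crossError, Sum.elim_inr, ← hQ, Finset.mem_union]
      by_cases hx : x = b
      · subst hx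
        by_cases hyP : y ∈ Q
        · simp [hyP, h1 hyP, CharTwo.add_self_eq_zero]
        · by_cases hyC : y ∈ D
          · simp only [hyP, hyC]
            simp
            split_ifs <;> simp
          · simp [hyP, hyC]
      · simp [hx]
  rw [hammingNorm_crossError, hammingNorm_crossError] at h
  omega

/-- A critical generator yields an improvement inside it. -/
lemma exists_isImprovement_of_critical (e : Qubit A B → ZMod 2) (a : A) (b : B) (M C : Finset A)
    (L D : Finset B) (hM : M ∪ C = rightNbrs G b) (hL : L ∪ D = leftNbrs G a)
    (hs : ∀ x ∈ M, ∀ y ∈ L, syndrome G e (x, y) = e (Sum.inl (x, a)) + e (Sum.inr (b, y)))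
    (hMC : 2 * C.card < M.card) (hLD : 2 * D.card < L.card)
    (hne : ∃ y ∈ L, e (Sum.inr (b, y)) ≠ 0) :
    ∃ P Q, IsImprovement G e (crossError a b P Q) := by
  set P := M.filter fun x => e (Sum.inl (x, a)) ≠ 0 with hPdef
  set P' := M.filter fun x => ¬ e (Sum.inl (x, a)) ≠ 0 with hPdef'
  set Q := L.filter fun y => e (Sum.inr (b, y)) ≠ 0 with hQdef
  set Q' := L.filter fun y => ¬ e (Sum.inr (b, y)) ≠ 0 with hQdef'
  have hPP : Disjoint P P' := Finset.disjoint_filter_filter_not _ _ _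
  have hQQ : Disjoint Q Q' := Finset.disjoint_filter_filter_not _ _ _
  have hPu : P ∪ P' = M := Finset.filter_union_filter_not_eq _ _
  have hQu : Q ∪ Q' = L := Finset.filter_union_filter_not_eq _ _
  have hPc : P.card + P'.card = M.card := Finset.card_filter_add_card_filter_not _
  have hQc : Q.card + Q'.card = L.card := Finset.card_filter_add_card_filter_not _
  have hQpos : 0 < Q.card := by
    obtain ⟨y, hy, h⟩ := hne
    exact Finset.card_pos.2 ⟨y, Finset.mem_filter.2 ⟨hy, h⟩⟩
  have hs1 : ∀ x ∈ P, ∀ y ∈ Q', syndrome G e (x, y) = 1 := by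
    intro x hx y hy
    rw [hPdef, Finset.mem_filter] at hx
    rw [hQdef', Finset.mem_filter, not_not] at hy
    rw [hs x hx.1 y hy.1, hy.2, add_zero, zmod_two_eq_one_of_ne_zero hx.2]
  have hs2 : ∀ x ∈ P', ∀ y ∈ Q, syndrome G e (x, y) = 1 := by
    intro x hx y hy
    rw [hPdef', Finset.mem_filter, not_not] at hx
    rw [hQdef, Finset.mem_filter] at hy
    rw [hs x hx.1 y hy.1, hx.2, zero_add, zmod_two_eq_one_of_ne_zero hy.2]
  -- When the error fills the whole unique part, `M × L` has no unsatisfied check to exploit and the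
  -- complement is empty; the full generator is added instead.
  by_cases hzero : P'.card + Q'.card = 0
  · refine ⟨rightNbrs G b, leftNbrs G a, Or.inl ⟨generator_mem_dualCode G a b,
      hammingNorm_add_generator_lt G e a b P C Q D ?_ ?_ ?_ ?_ (by omega)⟩⟩
    · rw [← hM, ← hPu, Finset.card_eq_zero.1 (by omega : P'.card = 0), Finset.union_empty]
    · rw [← hL, ← hQu, Finset.card_eq_zero.1 (by omega : Q'.card = 0), Finset.union_empty]
    · exact fun x hx => zmod_two_eq_one_of_ne_zero (Finset.mem_filter.1 hx).2
    · exact fun x hx => zmod_two_eq_one_of_ne_zero (Finset.mem_filter.1 hx).2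
  rcases two_mul_decrease_ge P.card P'.card C.card Q.card Q'.card D.card (by omega) (by omega)
    with h | h
  · exact ⟨P, Q, isImprovement_cross G e a b P P' C Q Q' D hPP hQQ (by rw [hPu, hM])
      (by rw [hQu, hL]) hs1 hs2 (by omega) h⟩
  · exact ⟨P', Q', isImprovement_cross G e a b P' P C Q' Q D hPP.symm hQQ.symm
      (by rw [Finset.union_comm P', hPu, hM]) (by rw [Finset.union_comm Q', hQu, hL]) hs2 hs1
      (by omega) h⟩

lemma exists_isImprovement {S : Finset A} {T : Finset B} (hS : IsUniqueNbrRich (leftNbrs G) S)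
    (hT : IsUniqueNbrRich (rightNbrs G) T) {e : Qubit A B → ZMod 2} (he : IsSupportedIn S T e)
    (hne : e ≠ 0) : ∃ f, IsSupportedIn S T f ∧ IsImprovement G e f := by
  have hadj := mem_leftNbrs_iff_mem_rightNbrs G
  by_cases hA : ∃ x a, e (Sum.inl (x, a)) ≠ 0
  · set S' := univ.filter fun a => ∃ x, e (Sum.inl (x, a)) ≠ 0 with hS'
    have hmemS' : ∀ x a, e (Sum.inl (x, a)) ≠ 0 → a ∈ S' := fun x a h =>
      Finset.mem_filter.2 ⟨Finset.mem_univ _, x, h⟩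
    have hsub : S' ⊆ S := fun a ha => by
      obtain ⟨x, hx⟩ := (Finset.mem_filter.1 ha).2
      exact he.1 x a hx
    obtain ⟨a, ha, hrich⟩ := hS S' hsub (by
      obtain ⟨x, a, h⟩ := hA
      exact ⟨a, hmemS' x a h⟩)
    set L := uniqueNbrs (leftNbrs G) S' a with hL
    have hleft : ∀ x, ∀ y ∈ L, ∑ a' ∈ rightNbrs G y, e (Sum.inl (x, a')) = e (Sum.inl (x, a)) :=
      fun x y hy => sum_eq_of_mem_uniqueNbrs hadj hy (fun a' => e (Sum.inl (x, a'))) (hmemS' x)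
    -- Only rows meeting the error over `L` are kept: this suffices to read the syndrome on `L`, and
    -- ensures that the chosen `b` has an error qubit there.
    set T' := univ.filter fun b => ∃ y ∈ L, e (Sum.inr (b, y)) ≠ 0 with hT'
    have hmemT' : ∀ y ∈ L, ∀ b, e (Sum.inr (b, y)) ≠ 0 → b ∈ T' := fun y hy b h =>
      Finset.mem_filter.2 ⟨Finset.mem_univ _, y, hy, h⟩
    have hsubT : T' ⊆ T := fun b hb => by
      obtain ⟨y, _, hy⟩ := (Finset.mem_filter.1 hb).2
      exact he.2 b y hy
    rcases T'.eq_empty_or_nonempty with hempty | hnonempty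
    · obtain ⟨x, hx⟩ := (Finset.mem_filter.1 ha).2
      obtain ⟨b, -⟩ := Finset.card_pos.1 (Nat.zero_lt_of_lt hrich)
      refine ⟨crossError a b {x} ∅, isSupportedIn_crossError (fun _ => hsub ha) (by simp),
        isImprovement_left G e x a b L _ (uniqueNbrs_union_sharedNbrs _ S' a) ?_ (by omega)⟩
      intro y hy
      rw [syndrome_apply, hleft x y hy, Finset.sum_eq_zero, add_zero,
        zmod_two_eq_one_of_ne_zero hx]
      intro b' _
      by_contra h
      have := hmemT' y hy b' h
      rw [hempty] at this
      exact Finset.notMem_empty _ this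
    · obtain ⟨b, hb, hrich'⟩ := hT T' hsubT hnonempty
      obtain ⟨P, Q, h⟩ := exists_isImprovement_of_critical G e a b
        (uniqueNbrs (rightNbrs G) T' b) _ L _ (uniqueNbrs_union_sharedNbrs _ T' b)
        (uniqueNbrs_union_sharedNbrs _ S' a) (by
          intro x hx y hy
          rw [syndrome_apply, hleft x y hy, sum_eq_of_mem_uniqueNbrs (fun b a => (hadj a b).symm)
            hx (fun b' => e (Sum.inr (b', y))) (hmemT' y hy)])
        hrich' hrich (Finset.mem_filter.1 hb).2
      exact ⟨_, isSupportedIn_crossError (fun _ => hsub ha) (fun _ => hsubT hb), h⟩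
  · push Not at hA
    set T' := univ.filter fun b => ∃ y, e (Sum.inr (b, y)) ≠ 0 with hT'
    have hmemT' : ∀ y b, e (Sum.inr (b, y)) ≠ 0 → b ∈ T' := fun y b h =>
      Finset.mem_filter.2 ⟨Finset.mem_univ _, y, h⟩
    have hsubT : T' ⊆ T := fun b hb => by
      obtain ⟨y, hy⟩ := (Finset.mem_filter.1 hb).2
      exact he.2 b y hy
    obtain ⟨b, hb, hrich⟩ := hT T' hsubT (by
      obtain ⟨⟨x, a⟩ | ⟨b, y⟩, h⟩ := Function.ne_iff.1 hne
      · exact absurd (hA x a) h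
      · exact ⟨b, hmemT' y b h⟩)
    obtain ⟨y, hy⟩ := (Finset.mem_filter.1 hb).2
    obtain ⟨a, -⟩ := Finset.card_pos.1 (Nat.zero_lt_of_lt hrich)
    refine ⟨crossError a b ∅ {y}, isSupportedIn_crossError (by simp) (fun _ => hsubT hb),
      isImprovement_right G e a b y _ _ (uniqueNbrs_union_sharedNbrs _ T' b) ?_ (by omega)⟩
    intro x hx
    rw [syndrome_apply, Finset.sum_eq_zero fun a' _ => hA x a', zero_add,
      sum_eq_of_mem_uniqueNbrs (fun b a => (hadj a b).symm) hx (fun b' => e (Sum.inr (b', y)))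
      (hmemT' y), zmod_two_eq_one_of_ne_zero hy]

/-! ### Descent and conclusion -/

/-- Lexicographic induction on syndrome weight, then weight: stabilizer moves keep the former and
lower the latter, while for the other moves the syndrome drop pays for the flipped qubits. -/
lemma reducedWeight_le_three_mul_hammingNorm_syndrome {S : Finset A} {T : Finset B}
    (hS : IsUniqueNbrRich (leftNbrs G) S) (hT : IsUniqueNbrRich (rightNbrs G) T)
    (e : Qubit A B → ZMod 2) (he : IsSupportedIn S T e) :
    reducedWeight G e ≤ 3 * hammingNorm (syndrome G e) := by
  induction hs : hammingNorm (syndrome G e) using Nat.strong_induction_on generalizing e with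
  | _ s ihs =>
  induction hw : hammingNorm e using Nat.strong_induction_on generalizing e with
  | _ w ihw =>
  by_cases hne : e = 0
  · have h := reducedWeight_le G (e := e) (Submodule.zero_mem _)
    rw [hne, add_zero, hammingNorm_zero] at h
    rw [hne]
    omega
  obtain ⟨f, hf, ⟨hmem, hlt⟩ | ⟨hlt, hle⟩⟩ := exists_isImprovement G hS hT he hne
  · have hsyn : syndrome G (e + f) = syndrome G e := by
      rw [syndrome_add, syndrome_eq_zero_of_mem_dualCode G hmem, add_zero]
    exact (reducedWeight_le_reducedWeight_add G hmem).trans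
      (ihw _ (hw ▸ hlt) (e + f) (he.add hf) (by rw [hsyn, hs]) rfl)
  · have h1 := ihs _ (hs ▸ hlt) (e + f) (he.add hf) rfl
    have h2 := reducedWeight_le_add G e f
    omega

lemma isUniqueNbrRich_leftNbrs {ΔA ΔB : ℕ} {γ δ : ℝ} (h : IsBiregularBipartite G ΔA ΔB)
    (hΔ : 0 < ΔA) (hδ : δ < 1 / 6) (hexp : IsLeftExpanding G ΔA γ δ) {S : Finset A}
    (hS : (S.card : ℝ) ≤ γ * Fintype.card A) : IsUniqueNbrRich (leftNbrs G) S := by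
  intro S' hS' hne
  refine exists_many_unique_neighbors _ S' hne ΔA hΔ δ hδ (fun a _ => ?_) ?_
  · rw [← h.left_degree a, ← G.card_neighborFinset_eq_degree, neighborFinset_inl G h,
      Finset.card_map]
  · have h1 := hexp S' ((Nat.cast_le.2 (Finset.card_le_card hS')).trans hS)
    simp_rw [neighborFinset_inl G h] at h1
    have h2 : (S'.biUnion fun a => (leftNbrs G a).map Function.Embedding.inr) =
        (S'.biUnion (leftNbrs G)).map (Function.Embedding.inr : B ↪ A ⊕ B) := by
      ext v
      simp only [Finset.mem_biUnion, Finset.mem_map]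
      grind
    rwa [h2, Finset.card_map] at h1

lemma isUniqueNbrRich_rightNbrs {ΔA ΔB : ℕ} {γ δ : ℝ} (h : IsBiregularBipartite G ΔA ΔB)
    (hΔ : 0 < ΔB) (hδ : δ < 1 / 6) (hexp : IsRightExpanding G ΔB γ δ) {T : Finset B}
    (hT : (T.card : ℝ) ≤ γ * Fintype.card B) : IsUniqueNbrRich (rightNbrs G) T := by
  intro T' hT' hne
  refine exists_many_unique_neighbors _ T' hne ΔB hΔ δ hδ (fun b _ => ?_) ?_
  · rw [← h.right_degree b, ← G.card_neighborFinset_eq_degree, neighborFinset_inr G h,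
      Finset.card_map]
  · have h1 := hexp T' ((Nat.cast_le.2 (Finset.card_le_card hT')).trans hT)
    simp_rw [neighborFinset_inr G h] at h1
    have h2 : (T'.biUnion fun b => (rightNbrs G b).map Function.Embedding.inl) =
        (T'.biUnion (rightNbrs G)).map (Function.Embedding.inl : A ↪ A ⊕ B) := by
      ext v
      simp only [Finset.mem_biUnion, Finset.mem_map]
      grind
    rwa [h2, Finset.card_map] at h1

end QuantumExpander

theorem mainTheorem2 {A B : Type*} [Fintype A] [Fintype B] [DecidableEq A] [DecidableEq B]
    (G : SimpleGraph (A ⊕ B)) [DecidableRel G.Adj] (ΔA ΔB : ℕ) (γA δA γB δB : ℝ)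
    (hcard : Fintype.card B ≤ Fintype.card A) (hΔA : 0 < ΔA)
    (hγA : 0 < γA) (hδA : 0 < δA) (hγB : 0 < γB) (hδB : 0 < δB)
    (hreg : QuantumExpander.IsBiregularBipartite G ΔA ΔB)
    (hleft : QuantumExpander.IsLeftExpanding G ΔA γA δA)
    (hright : QuantumExpander.IsRightExpanding G ΔB γB δB)
    (hδA6 : δA < 1 / 6) (hδB6 : δB < 1 / 6)
    (e : QuantumExpander.Qubit A B → ZMod 2)
    (he : (QuantumExpander.reducedWeight G e : ℝ) <
      min (γA * Fintype.card A) (γB * Fintype.card B)) :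
    (1 / 3 : ℝ) * QuantumExpander.reducedWeight G e ≤
      (hammingNorm (QuantumExpander.syndrome G e) : ℝ) := by
  open QuantumExpander in
  obtain ⟨f, hf, hw⟩ := exists_reducedWeight_eq G e
  obtain ⟨S, T, hsupp, hS, hT⟩ := exists_isSupportedIn (e + f)
  rw [← hw] at hS hT
  have hposA : 0 < γA * Fintype.card A :=
    lt_of_le_of_lt (Nat.cast_nonneg _) (he.trans_le (min_le_left _ _))
  -- A vertex of `A` is needed to deduce `0 < ΔB` from `0 < ΔA`.
  obtain ⟨a⟩ : Nonempty A := by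
    rw [← Fintype.card_pos_iff]
    exact_mod_cast pos_of_mul_pos_right hposA hγA.le
  have h := reducedWeight_le_three_mul_hammingNorm_syndrome G
    (isUniqueNbrRich_leftNbrs G hreg hΔA hδA6 hleft
      ((Nat.cast_le.2 hS).trans (he.le.trans (min_le_left _ _))))
    (isUniqueNbrRich_rightNbrs G hreg (right_degree_pos G hreg hΔA a) hδB6 hright
      ((Nat.cast_le.2 hT).trans (he.le.trans (min_le_right _ _)))) (e + f) hsupp
  rw [syndrome_add, syndrome_eq_zero_of_mem_dualCode G hf, add_zero] at h
  have h' : (reducedWeight G e : ℝ) ≤ 3 * hammingNorm (syndrome G e) := by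
    exact_mod_cast (reducedWeight_le_reducedWeight_add G hf).trans h
  linarith
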